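/- Let $b\ge 2$ be an integer and let $\mathbb T_b$ be a homogeneous model tree with branching $b$ and root $x_0$: a connected simple graph with vertex set $X$, in which (writing $\rho$ for the combinatorial distance and $r(x)=\rho(x,x_0)$) no edge joins two vertices with the same value of $r$, the root has exactly $b$ neighbours, and every vertex $x\neq x_0$ has exactly one neighbour $y$ with $r(y)=r(x)-1$ and exactly $b$ neighbours $y$ with $r(y)=r(x)+1$. All edge weights and all vertex measures are $1$, so the Laplacian is $\Delta f(x)=\sum_{y\sim x}(f(y)-f(x))$. Let $\lambda_1=\inf\sigma(-\Delta)$ be the bottom of the spectrum of the bounded operator $-\Delta$ on $\ell^2(X)$. Let $k(x,y,t)$ be the heat kernel, i.e. the smallest nonnegative function solving $\partial_t k=\Delta_x k$ for $t>0$, $k(x,y,0)=\delta_{xy}$, and let $(P_t\varphi)(x)=\sum_{y\in X}k(x,y,t)\varphi(y)$. A global classical solution of $$u_t-\Delta u=u^p \ \text{ in } X\times(0,\infty),\qquad u=u_0\ \text{ in } X\times\{0\} \tag{1.1}$$ is a function $u:X\times[0,\infty)\to\mathbb R$ such that $u(x,\cdot)\in C^1((0,\infty))\cap C^0([0,\infty))$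 for every $x\in X$, $u$ is bounded on $X\times[0,\tau]$ for every $\tau>0$, $u\ge 0$ on $X\times(0,\infty)$, and (1.1) holds pointwise. A global classical supersolution of $u_t-\Delta u=u^p$ is a function with the same regularity, boundedness and nonnegativity that satisfies $u_t-\Delta u\ge u^p$ pointwise in $X\times(0,\infty)$. Let $p>1$ be real. Call a pair $(v_0,t_0)$ admissible if $v_0\in\ell^1(X)\cap\ell^\infty(X)$, $v_0(x)>0$ for all $x\in X$, and $$t_0>\max\Big\{0,\ \frac{1}{(p-1)\lambda_1}\log\Big[\frac{1}{\lambda_1}\|v_0\|_1^{\,p-1}\Big]\Big\},$$ and set $$\overline u(x,t)=h(t)\,(P_{t+t_0}v_0)(x),\qquad h(t)=\big[1-D\,(1-e^{-(p-1)\lambda_1 t})\big]^{-\frac1{p-1}},\qquad D=\frac{1}{\lambda_1}\|v_0\|_1^{\,p-1}e^{-(p-1)\lambda_1t_0}.$$ Then admissible pairs exist, and for every admissible pair: $\overline u$ is a global classical supersolution of $u_t-\Delta u=u^p$ in $X\times(0,\infty)$; $\overline u>0$ on $X\times[0,\infty)$; and for every $u_0:X\to\mathbb R$ with $$0\le u_0(x)\le\overline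 u(x,0)\qquad\text{for all }x\in X,$$ problem (1.1) has a global classical solution. -/

import Mathlib

noncomputable section

namespace ModelTree

open Set

variable {V : Type*}

/-- `G` is a homogeneous model tree with root `x₀` and branching `b`. A simple graph is the same
as an edge weight `ω₀` with values in `{0, 1}` (`ω₀ x y = 1` iff `x ∼ y`), and the node measure is
identically `1`. Cardinalities are taken in `ℕ∞`, so all the neighbour sets below are finite. -/
structure IsHomogeneousModelTree (G : SimpleGraph V) (b : ℕ) (x₀ : V) : Prop where
  connected : G.Connected
  /-- No edges inside a shell `S_r(x₀)`. -/
  not_adj_of_dist_eq : ∀ x y : V, G.dist x x₀ = G.dist y x₀ → ¬ G.Adj x y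
  root_degree : (G.neighborSet x₀).encard = b
  /-- Every vertex other than the root has exactly one neighbour one step closer to the root. -/
  encard_parents : ∀ x : V, x ≠ x₀ →
    {y : V | G.Adj x y ∧ G.dist y x₀ + 1 = G.dist x x₀}.encard = 1
  /-- Every vertex other than the root has exactly `b` neighbours one step farther from it. -/
  encard_children : ∀ x : V, x ≠ x₀ →
    {y : V | G.Adj x y ∧ G.dist y x₀ = G.dist x x₀ + 1}.encard = b

/-- The graph Laplacian for edge weights `0, 1` and node measure `1`:
`Δ f (x) = ∑_{y ∼ x} (f y - f x)` (a finite sum on locally finite graphs). -/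
def laplacian (G : SimpleGraph V) (f : V → ℝ) (x : V) : ℝ :=
  ∑ᶠ y ∈ G.neighborSet x, (f y - f x)

/-- `w ∈ C¹((0, ∞)) ∩ C⁰([0, ∞))`. -/
def TimeRegular (w : ℝ → ℝ) : Prop :=
  ContinuousOn w (Ici 0) ∧ ContDiffOn ℝ 1 w (Ioi 0)

/-- `u` is locally bounded in time, uniformly in space: `u ∈ L^∞(X × [0, τ])` for all `τ > 0`. -/
def LocallyBounded (u : V → ℝ → ℝ) : Prop :=
  ∀ τ : ℝ, 0 < τ → ∃ C : ℝ, ∀ x : V, ∀ t ∈ Icc 0 τ, |u x t| ≤ C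

/-- `u` is a global classical (nonnegative) solution of the Cauchy problem
`u_t - Δ u = u ^ p` in `X × (0, ∞)`, `u = u₀` in `X × {0}`. -/
structure IsGlobalSolution (G : SimpleGraph V) (p : ℝ) (u₀ : V → ℝ) (u : V → ℝ → ℝ) : Prop where
  regular : ∀ x, TimeRegular (u x)
  bounded : LocallyBounded u
  equation : ∀ x, ∀ t, 0 < t → deriv (u x) t - laplacian G (fun y => u y t) x = u x t ^ p
  initial : ∀ x, u x 0 = u₀ x
  nonneg : ∀ x, ∀ t, 0 < t → 0 ≤ u x t

/-- `u` is a global classical supersolution of the equation `u_t - Δ u = u ^ p`. -/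
structure IsGlobalSupersolution (G : SimpleGraph V) (p : ℝ) (u : V → ℝ → ℝ) : Prop where
  regular : ∀ x, TimeRegular (u x)
  bounded : LocallyBounded u
  inequality : ∀ x, ∀ t, 0 < t → u x t ^ p ≤ deriv (u x) t - laplacian G (fun y => u y t) x
  nonneg : ∀ x, ∀ t, 0 < t → 0 ≤ u x t

open Classical in
/-- `q = q(x, y, t)` is a nonnegative solution of `q_t - Δ q = 0` in `X × X × (0, ∞)` (with `Δ`
acting on `x`) with `q(x, y, 0) = δ_{xy}`. -/
structure IsFundamentalSolution (G : SimpleGraph V) (q : V → V → ℝ → ℝ) : Prop where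
  regular : ∀ x y, TimeRegular (q x y)
  equation : ∀ x y, ∀ t, 0 < t → deriv (q x y) t - laplacian G (fun z => q z y t) x = 0
  initial : ∀ x y, q x y 0 = if x = y then 1 else 0
  nonneg : ∀ x y, ∀ t, 0 ≤ t → 0 ≤ q x y t

/-- The heat kernel: the smallest nonnegative fundamental solution, for times `t ≥ 0`. -/
def heatKernel (G : SimpleGraph V) (x y : V) (t : ℝ) : ℝ :=
  sInf {r : ℝ | ∃ q : V → V → ℝ → ℝ, IsFundamentalSolution G q ∧ r = q x y t}

/-- The heat semigroup `(P_t φ)(x) = ∑_y p(x, y, t) φ(y)` (the node measure is `1`). -/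
def heatSemigroup (G : SimpleGraph V) (t : ℝ) (φ : V → ℝ) (x : V) : ℝ :=
  ∑' y : V, heatKernel G x y t * φ y

/-- The `ℓ²`-spectrum of `-Δ`: the spectrum of the bounded operator `T` on the real Hilbert space
`ℓ²(X)` given by `T f = -Δ f` (such a `T` is unique, and exists when the degrees are bounded). -/
def l2Spectrum (G : SimpleGraph V) : Set ℝ :=
  {l : ℝ | ∃ T : lp (fun _ : V => ℝ) 2 →L[ℝ] lp (fun _ : V => ℝ) 2,
    (∀ (f : lp (fun _ : V => ℝ) 2) (x : V), T f x = - laplacian G (fun y => f y) x) ∧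
      l ∈ spectrum ℝ T}

/-- The bottom `λ₁` of the `ℓ²`-spectrum of `-Δ`. -/
def lambdaOne (G : SimpleGraph V) : ℝ := sInf (l2Spectrum G)

/-- The `ℓ¹`-norm of a function (meaningful for summable functions). -/
def l1Norm (v : V → ℝ) : ℝ := ∑' x : V, |v x|

/-- The constant `D = λ₁⁻¹ ‖v₀‖₁ ^ (p - 1) exp (-(p - 1) λ₁ t₀)`. -/
def constD (G : SimpleGraph V) (p : ℝ) (v₀ : V → ℝ) (t₀ : ℝ) : ℝ :=
  1 / lambdaOne G * l1Norm v₀ ^ (p - 1) * Real.exp (-(p - 1) * lambdaOne G * t₀)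

/-- The factor `h(t) = (1 - D (1 - exp (-(p - 1) λ₁ t))) ^ (-1 / (p - 1))`. -/
def hFactor (G : SimpleGraph V) (p : ℝ) (v₀ : V → ℝ) (t₀ t : ℝ) : ℝ :=
  (1 - constD G p v₀ t₀ * (1 - Real.exp (-(p - 1) * lambdaOne G * t))) ^ (-(1 / (p - 1)))

/-- The supersolution `ū(x, t) = h(t) (P_{t + t₀} v₀)(x)`. -/
def superSol (G : SimpleGraph V) (p : ℝ) (v₀ : V → ℝ) (t₀ : ℝ) (x : V) (t : ℝ) : ℝ :=
  hFactor G p v₀ t₀ t * heatSemigroup G (t + t₀) v₀ x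

/-- The parameters for which the supersolution is built: `v₀ ∈ ℓ¹ ∩ ℓ^∞` is pointwise positive
and `t₀ > max {0, ((p - 1) λ₁)⁻¹ log (λ₁⁻¹ ‖v₀‖₁ ^ (p - 1))}`. -/
structure IsAdmissible (G : SimpleGraph V) (p : ℝ) (v₀ : V → ℝ) (t₀ : ℝ) : Prop where
  pos : ∀ x, 0 < v₀ x
  summable : Summable v₀
  bounded : ∃ C : ℝ, ∀ x, v₀ x ≤ C
  lt_time : max 0 (1 / ((p - 1) * lambdaOne G) *
    Real.log (1 / lambdaOne G * l1Norm v₀ ^ (p - 1))) < t₀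

end ModelTree

end

noncomputable section

namespace ModelTree

open Set Filter Topology
open scoped RealInnerProductSpace

variable {V : Type*}

/-! The weight `b ^ (-r / 2)` is a strict supersolution of the Laplace equation, so AM-GM along
edges gives `(√b - 1) ^ 2` as a lower bound for the quadratic form of `-Δ`, whence `λ₁ > 0`
(`inner_lazyOp_self_le`, `sum_neighbors_pow_le`). Since the optimal form bound lies in the spectrum,
the form is also bounded below by `λ₁` itself (`le_lambdaOne`).

With `K` bounding the degrees, `A = Δ + K` is bounded on `ℓ²` and positivity preserving. The flow
`exp (-K t) exp (t A)` has the minimal heat kernel as its matrix entries (`heatKernel_eq`). The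
energy estimate bounds these by `exp (-λ₁ t)`, so `P_t v₀ ≤ exp (-λ₁ t) ‖v₀‖₁` for positive summable
`v₀`.

Put `P = P_{t + t₀} v₀`. As `P` solves the heat equation, `(h P)_t - Δ (h P) = h' P`. The factor `h`
solves `h' = a h ^ p`, where `a` is the `(p - 1)`-st power of the above bound at time `t + t₀`; so
`h' P ≥ (h P) ^ p`. The condition on `t₀` says `D < 1`, which keeps `h` finite for all time.

A solution below this supersolution is the limit of an increasing Picard iteration started at `0`;
the integrating factor `exp (K t)` makes the integral operator monotone. -/

/-- The Hilbert space `ℓ²(V)` of real functions. -/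
abbrev L2 (V : Type*) := lp (fun _ : V => ℝ) 2

/-! ### Summation over oriented edges -/

section Graph

variable (G : SimpleGraph V) [G.LocallyFinite]

theorem laplacian_eq (f : V → ℝ) (x : V) :
    laplacian G f x = ∑ y ∈ G.neighborFinset x, f y - G.degree x * f x := by
  unfold laplacian
  rw [← SimpleGraph.coe_neighborFinset, finsum_mem_coe_finset, Finset.sum_sub_distrib]
  simp

/-- Exchange of the two endpoints on the set of oriented edges. -/
def edgeSwap : (Σ x : V, {y // y ∈ G.neighborFinset x}) ≃ Σ x : V, {y // y ∈ G.neighborFinset x} where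
  toFun d := ⟨d.2.1, d.1, (G.mem_neighborFinset _ _).2 ((G.mem_neighborFinset _ _).1 d.2.2).symm⟩
  invFun d := ⟨d.2.1, d.1, (G.mem_neighborFinset _ _).2 ((G.mem_neighborFinset _ _).1 d.2.2).symm⟩
  left_inv _ := rfl
  right_inv _ := rfl

variable {G}

theorem summable_edges_of_nonneg {F : V → V → ℝ} (hF : ∀ x y, 0 ≤ F x y)
    (h : Summable fun x => ∑ y ∈ G.neighborFinset x, F x y) :
    Summable fun d : Σ x : V, {y // y ∈ G.neighborFinset x} => F d.1 d.2 := by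
  rw [summable_sigma_of_nonneg fun d => hF _ _]
  refine ⟨fun x => Summable.of_finite, h.congr fun x => ?_⟩
  rw [tsum_fintype, Finset.sum_coe_sort (G.neighborFinset x) (fun y => F x y)]

theorem hasSum_edges {F : V → V → ℝ}
    (h : Summable fun d : Σ x : V, {y // y ∈ G.neighborFinset x} => F d.1 d.2) :
    HasSum (fun x => ∑ y ∈ G.neighborFinset x, F x y)
      (∑' d : Σ x : V, {y // y ∈ G.neighborFinset x}, F d.1 d.2) := by
  refine h.hasSum.sigma fun x => ?_
  rw [← Finset.sum_coe_sort (G.neighborFinset x) (fun y => F x y)]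
  exact hasSum_fintype _

/-- Reversing all edges permutes the oriented edges; this is the discrete integration by parts
behind the symmetry of `Δ` and the form estimates. -/
theorem hasSum_edges_symm {F : V → V → ℝ}
    (h : Summable fun d : Σ x : V, {y // y ∈ G.neighborFinset x} => F d.1 d.2) :
    HasSum (fun x => ∑ y ∈ G.neighborFinset x, F y x)
      (∑' d : Σ x : V, {y // y ∈ G.neighborFinset x}, F d.1 d.2) := by
  rw [← (edgeSwap G).tsum_eq (fun d => F d.1 d.2)]
  exact hasSum_edges (F := fun x y => F y x) ((edgeSwap G).summable_iff.mpr h)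

theorem L2.hasSum_sq (f : L2 V) : HasSum (fun x => f x ^ 2) (‖f‖ ^ 2) := by
  simpa using lp.hasSum_norm (p := 2) (by simp) f

theorem L2.hasSum_mul (f g : L2 V) : HasSum (fun x => f x * g x) ⟪f, g⟫ := by
  simpa [mul_comm] using lp.hasSum_inner (𝕜 := ℝ) f g

theorem L2.memℓp_iff {f : V → ℝ} : Memℓp f 2 ↔ Summable fun x => f x ^ 2 := by
  rw [memℓp_gen_iff (by simp)]
  simp

theorem L2.abs_apply_le (f : L2 V) (x : V) : |f x| ≤ ‖f‖ :=
  lp.norm_apply_le_norm (by simp) f x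

variable {K : ℕ} (hK : ∀ x, G.degree x ≤ K)
include hK

theorem summable_edges_fst {g : V → ℝ} (hg : ∀ x, 0 ≤ g x) (hs : Summable g) :
    Summable fun d : Σ x : V, {y // y ∈ G.neighborFinset x} => g d.1 := by
  refine summable_edges_of_nonneg (F := fun x _ => g x) (fun x _ => hg x) ?_
  refine .of_nonneg_of_le (fun x => Finset.sum_nonneg fun _ _ => hg x) (fun x => ?_)
    (hs.mul_left (K : ℝ))
  simp only [Finset.sum_const, nsmul_eq_mul, SimpleGraph.card_neighborFinset_eq_degree]
  gcongr
  · exact hg x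
  · exact hK x

theorem summable_edges_snd {g : V → ℝ} (hg : ∀ x, 0 ≤ g x) (hs : Summable g) :
    Summable fun d : Σ x : V, {y // y ∈ G.neighborFinset x} => g d.2 :=
  (edgeSwap G).summable_iff.mpr (summable_edges_fst hK hg hs)

theorem summable_edges_mul (f g : L2 V) :
    Summable fun d : Σ x : V, {y // y ∈ G.neighborFinset x} => f d.1 * g d.2 := by
  refine .of_norm_bounded ((summable_edges_fst hK (fun x => sq_nonneg (f x))
    (L2.hasSum_sq f).summable).add (summable_edges_snd hK (fun x => sq_nonneg (g x))
    (L2.hasSum_sq g).summable)) fun d => ?_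
  rw [Real.norm_eq_abs, abs_mul]
  nlinarith [sq_abs (f d.1), sq_abs (g d.2), sq_nonneg (|f d.1| - |g d.2|), sq_nonneg (f d.1),
    sq_nonneg (g d.2)]

theorem exists_hasSum_sum_neighbors {g : V → ℝ} (hg : ∀ x, 0 ≤ g x) (hs : Summable g) :
    ∃ s ≤ K * ∑' x, g x, HasSum (fun x => ∑ y ∈ G.neighborFinset x, g y) s := by
  have h := summable_edges_fst hK hg hs
  refine ⟨_, ?_, hasSum_edges_symm (F := fun x _ => g x) h⟩
  refine hasSum_le (fun x => ?_) (hasSum_edges (F := fun x _ => g x) h) (hs.hasSum.mul_left _)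
  simp only [Finset.sum_const, nsmul_eq_mul, SimpleGraph.card_neighborFinset_eq_degree]
  gcongr
  · exact hg x
  · exact hK x

end Graph

/-! ### The bounded symmetric operator `Δ + K` and its form bound -/

section LazyOperator

variable (G : SimpleGraph V) [G.LocallyFinite] (K : ℕ)

/-- The function `Δ f + K f`, which has nonnegative coefficients if all degrees are at most `K`. -/
def lazySum (f : V → ℝ) (x : V) : ℝ :=
  ∑ y ∈ G.neighborFinset x, f y + (K - G.degree x) * f x

variable {G K}

theorem laplacian_eq_lazySum (f : V → ℝ) (x : V) :
    laplacian G f x = lazySum G K f x - K * f x := by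
  rw [laplacian_eq, lazySum]
  ring

variable (hK : ∀ x, G.degree x ≤ K)
include hK

theorem lazySum_mono {f g : V → ℝ} (h : ∀ x, f x ≤ g x) (x : V) :
    lazySum G K f x ≤ lazySum G K g x := by
  have : (0 : ℝ) ≤ K - G.degree x := sub_nonneg.mpr (by exact_mod_cast hK x)
  exact add_le_add (Finset.sum_le_sum fun y _ => h y) (mul_le_mul_of_nonneg_left (h x) this)

/-- Cauchy-Schwarz over at most `K` neighbours, followed by `(a + b)² ≤ 2 a² + 2 b²`. -/
theorem lazySum_sq_le (f : V → ℝ) (x : V) :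
    lazySum G K f x ^ 2 ≤ 2 * K * ∑ y ∈ G.neighborFinset x, f y ^ 2 + 2 * K ^ 2 * f x ^ 2 := by
  have h1 : (∑ y ∈ G.neighborFinset x, f y) ^ 2 ≤ K * ∑ y ∈ G.neighborFinset x, f y ^ 2 := by
    refine sq_sum_le_card_mul_sum_sq.trans
      (mul_le_mul_of_nonneg_right ?_ (Finset.sum_nonneg fun _ _ => sq_nonneg _))
    exact_mod_cast hK x
  have h2 : ((K - G.degree x) * f x) ^ 2 ≤ K ^ 2 * f x ^ 2 := by
    have : (G.degree x : ℝ) ≤ K := by exact_mod_cast hK x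
    rw [mul_pow]
    gcongr
    linarith [Nat.cast_nonneg (α := ℝ) (G.degree x)]
  unfold lazySum
  nlinarith [sq_nonneg (∑ y ∈ G.neighborFinset x, f y - (K - G.degree x) * f x)]

theorem exists_hasSum_lazySum_sq (f : L2 V) :
    ∃ s ≤ (2 * K * ‖f‖) ^ 2, HasSum (fun x => lazySum G K f x ^ 2) s := by
  obtain ⟨s, hs, h⟩ := exists_hasSum_sum_neighbors hK (fun x => sq_nonneg (f x))
    (L2.hasSum_sq f).summable
  rw [(L2.hasSum_sq f).tsum_eq] at hs
  have h' := (h.mul_left (2 * K : ℝ)).add ((L2.hasSum_sq f).mul_left (2 * K ^ 2 : ℝ))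
  have hS : Summable fun x => lazySum G K f x ^ 2 :=
    .of_nonneg_of_le (fun x => sq_nonneg _) (fun x => lazySum_sq_le hK f x) h'.summable
  refine ⟨_, (hasSum_le (fun x => lazySum_sq_le hK f x) hS.hasSum h').trans ?_, hS.hasSum⟩
  calc 2 * (K : ℝ) * s + 2 * K ^ 2 * ‖f‖ ^ 2
      ≤ 2 * (K : ℝ) * (K * ‖f‖ ^ 2) + 2 * K ^ 2 * ‖f‖ ^ 2 := by gcongr
    _ = (2 * K * ‖f‖) ^ 2 := by ring

theorem memℓp_lazySum (f : L2 V) : Memℓp (lazySum G K f) 2 :=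
  have ⟨_, _, h⟩ := exists_hasSum_lazySum_sq hK f
  L2.memℓp_iff.mpr h.summable

/-- The operator `Δ + K` on `ℓ²(V)`, as a linear map. -/
def lazyLinear : L2 V →ₗ[ℝ] L2 V where
  toFun f := ⟨lazySum G K f, memℓp_lazySum hK f⟩
  map_add' f g := by
    ext x
    simp only [lazySum, lp.coeFn_add, Pi.add_apply, Finset.sum_add_distrib]
    ring
  map_smul' c f := by
    ext x
    simp only [lazySum, lp.coeFn_smul, Pi.smul_apply, smul_eq_mul, ← Finset.mul_sum,
      RingHom.id_apply]
    ring

theorem norm_lazyLinear_le (f : L2 V) : ‖lazyLinear hK f‖ ≤ 2 * K * ‖f‖ := by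
  obtain ⟨s, hs, h⟩ := exists_hasSum_lazySum_sq hK f
  have h' : ‖lazyLinear hK f‖ ^ 2 = s := (L2.hasSum_sq (lazyLinear hK f)).unique h
  exact le_of_sq_le_sq (h'.trans_le hs) (by positivity)

/-- The bounded operator `Δ + K` on `ℓ²(V)`. -/
def lazyOp : L2 V →L[ℝ] L2 V :=
  (lazyLinear hK).mkContinuous (2 * K) (norm_lazyLinear_le hK)

@[simp]
theorem lazyOp_apply (f : L2 V) (x : V) : lazyOp hK f x = lazySum G K f x := rfl

theorem hasSum_lazySum_mul (f g : L2 V) :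
    HasSum (fun x => lazySum G K f x * g x)
      (∑' d : Σ x : V, {y // y ∈ G.neighborFinset x}, f d.1 * g d.2 +
        ∑' x, (K - G.degree x) * (f x * g x)) := by
  have h1 := hasSum_edges_symm (F := fun x y => f x * g y) (summable_edges_mul hK f g)
  have h2 : Summable fun x => ((K : ℝ) - G.degree x) * (f x * g x) := by
    refine .of_norm_bounded ((L2.hasSum_mul f g).summable.norm.mul_left (K : ℝ)) fun x => ?_
    have : (G.degree x : ℝ) ≤ K := by exact_mod_cast hK x
    rw [norm_mul, Real.norm_of_nonneg (by linarith)]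
    gcongr
    linarith [Nat.cast_nonneg (α := ℝ) (G.degree x)]
  convert h1.add h2.hasSum using 2 with x
  rw [lazySum, ← Finset.sum_mul]
  ring

theorem inner_lazyOp_comm (f g : L2 V) : ⟪lazyOp hK f, g⟫ = ⟪f, lazyOp hK g⟫ := by
  have h1 := (L2.hasSum_mul (lazyOp hK f) g).unique (hasSum_lazySum_mul hK f g)
  have h2 := (L2.hasSum_mul (lazyOp hK g) f).unique (hasSum_lazySum_mul hK g f)
  have h3 : ∑' d : Σ x : V, {y // y ∈ G.neighborFinset x}, g d.1 * f d.2 =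
      ∑' d : Σ x : V, {y // y ∈ G.neighborFinset x}, f d.1 * g d.2 := by
    rw [← (edgeSwap G).tsum_eq]
    exact tsum_congr fun d => mul_comm _ _
  rw [real_inner_comm (lazyOp hK g) f, h1, h2, h3]
  simp only [mul_comm (f _)]

/-- A positive strict supersolution `φ` of the Laplace equation gives a spectral gap. -/
theorem inner_lazyOp_self_le {φ : V → ℝ} {c : ℝ} (hc : 0 ≤ c) (hφ : ∀ x, 0 < φ x)
    (hsup : ∀ x, ∑ y ∈ G.neighborFinset x, φ y ≤ (G.degree x - c) * φ x) (f : L2 V) :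
    ⟪lazyOp hK f, f⟫ ≤ (K - c) * ‖f‖ ^ 2 := by
  -- Each edge term `f x * f y` will be bounded by half the sum of `F x y` and `F y x`. Summing `F`
  -- over edges from `x` brings in the supersolution inequality.
  set F : V → V → ℝ := fun x y => f x ^ 2 * (φ y / φ x)
  have hF : ∀ x y, 0 ≤ F x y := fun x y =>
    mul_nonneg (sq_nonneg _) (div_nonneg (hφ y).le (hφ x).le)
  have hsum : ∀ x, ∑ y ∈ G.neighborFinset x, F x y ≤ (G.degree x - c) * f x ^ 2 := fun x => by
    rw [← Finset.mul_sum, ← Finset.sum_div, mul_comm]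
    gcongr
    rw [div_le_iff₀ (hφ x)]
    exact hsup x
  have hS : Summable fun x => ∑ y ∈ G.neighborFinset x, F x y := by
    refine .of_nonneg_of_le (fun x => Finset.sum_nonneg fun y _ => hF x y) (fun x => ?_)
      ((L2.hasSum_sq f).summable.mul_left (K : ℝ))
    refine (hsum x).trans ?_
    gcongr
    have : (G.degree x : ℝ) ≤ K := by exact_mod_cast hK x
    linarith
  have hE := summable_edges_of_nonneg hF hS
  have h := ((hasSum_edges hE).add (hasSum_edges_symm hE)).mul_left (1 / 2 : ℝ)
  have h3 := hasSum_edges (F := fun x y => f x * f y) (summable_edges_mul hK f f)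
  have h4 := hasSum_le (fun x => ?_) h3 h
  · have h5 := hasSum_lazySum_mul hK f f
    have h6 := (L2.hasSum_mul (lazyOp hK f) f).unique h5
    have h7 := h5.sub h3
    have h8 := h7.add (hasSum_edges hE)
    have h9 := hasSum_le (fun x => ?_) h8 ((L2.hasSum_sq f).mul_left (K - c))
    · rw [h6]
      linarith
    · have := hsum x
      rw [lazySum, ← Finset.mul_sum]
      nlinarith
  · rw [← Finset.sum_add_distrib, Finset.mul_sum]
    refine Finset.sum_le_sum fun y _ => ?_
    have hx := hφ x
    have hy := hφ y
    -- AM-GM with weights `φ y / φ x` and its inverse: the defect is a square over a positive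
    -- number.
    have key : f x ^ 2 * (φ y / φ x) + f y ^ 2 * (φ x / φ y) - 2 * (f x * f y) =
        (f x * φ y - f y * φ x) ^ 2 / (φ x * φ y) := by
      field_simp
      ring
    have : 0 ≤ (f x * φ y - f y * φ x) ^ 2 / (φ x * φ y) := by positivity
    simp only [F]
    linarith

end LazyOperator

end ModelTree
end

noncomputable section

namespace ModelTree

open Set Filter Topology
open scoped RealInnerProductSpace

/-! ### Form bounds and the bottom of the spectrum -/

section Spectrum

variable {E : Type*} [NormedAddCommGroup E] [InnerProductSpace ℝ E]

/-- For `l < c` the operator `T - l` is coercive, hence invertible by Lax-Milgram. -/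
theorem le_of_mem_spectrum [CompleteSpace E] {T : E →L[ℝ] E} {c l : ℝ} (h : ∀ f, c * ‖f‖ ^ 2 ≤ ⟪T f, f⟫)
    (hl : l ∈ spectrum ℝ T) : c ≤ l := by
  by_contra! hlt
  refine hl ?_
  rw [spectrum.mem_resolventSet_iff, ← IsUnit.neg_iff, neg_sub]
  refine ContinuousLinearMap.isUnit_of_forall_le_norm_inner_map _ (c := (c - l).toNNReal)
    (by simpa using hlt) fun f => le_trans ?_ (le_abs_self _)
  have : ⟪(T - algebraMap ℝ (E →L[ℝ] E) l) f, f⟫ = ⟪T f, f⟫ - l * ‖f‖ ^ 2 := by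
    rw [sub_apply, inner_sub_left, Algebra.algebraMap_eq_smul_one]
    simp [inner_smul_left]
  rw [this, Real.coe_toNNReal _ (by linarith)]
  linarith [h f]

/-- A semi-bounded symmetric operator has its optimal lower bound in the spectrum. -/
theorem exists_lower_bound_mem_spectrum [Nontrivial E] {T : E →L[ℝ] E}
    (hT : ∀ f g, ⟪T f, g⟫ = ⟪f, T g⟫) {c : ℝ} (h : ∀ f, c * ‖f‖ ^ 2 ≤ ⟪T f, f⟫) :
    ∃ m ∈ spectrum ℝ T, ∀ f, m * ‖f‖ ^ 2 ≤ ⟪T f, f⟫ := by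
  set A : Set ℝ := {m | ∀ f, m * ‖f‖ ^ 2 ≤ ⟪T f, f⟫}
  have hle : ∀ f : E, f ≠ 0 → ∀ m ∈ A, m ≤ ⟪T f, f⟫ / ‖f‖ ^ 2 := fun f hf m hm => by
    rw [le_div_iff₀ (by positivity)]
    exact hm f
  have hne : A.Nonempty := ⟨c, h⟩
  obtain ⟨f₀, hf₀⟩ := exists_ne (0 : E)
  have hbdd : BddAbove A := ⟨_, hle f₀ hf₀⟩
  have hmem : sSup A ∈ A := fun f => by
    rcases eq_or_ne f 0 with rfl | hf
    · simp
    · rw [← le_div_iff₀ (by positivity)]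
      exact csSup_le hne (hle f hf)
  -- If `T - m` were invertible at the optimal bound `m`, its form would be bounded below by a
  -- positive multiple of `‖f‖ ^ 2`, so `m` could be increased.
  refine ⟨sSup A, fun hu => ?_, hmem⟩
  set m := sSup A
  obtain ⟨S', hS'⟩ := hu.neg.exists_left_inv
  rw [neg_sub] at hS'
  set S : E →L[ℝ] E := T - algebraMap ℝ (E →L[ℝ] E) m with hSdef
  have hSa : ∀ f, S f = T f - m • f := fun f => by
    rw [hSdef, Algebra.algebraMap_eq_smul_one]
    simp
  have hSi : ∀ f, ⟪S f, f⟫ = ⟪T f, f⟫ - m * ‖f‖ ^ 2 := fun f => by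
    rw [hSa, inner_sub_left]
    simp [inner_smul_left]
  have hpos : ∀ f, 0 ≤ ⟪S f, f⟫ := fun f => by
    rw [hSi]
    linarith [hmem f]
  have hsymm : ∀ f g, ⟪S f, g⟫ = ⟪f, S g⟫ := fun f g => by
    simp only [hSa, inner_sub_left, inner_sub_right, hT, inner_smul_left, inner_smul_right]
    simp
  have hM : 0 < ‖S‖ + 1 := by positivity
  have hC : 0 < ‖S'‖ + 1 := by positivity
  have hquad : ∀ f, ‖S f‖ ^ 2 ≤ (‖S‖ + 1) * ⟪S f, f⟫ := fun f => by
    -- Positivity tested at `M f - S f`, with `M = ‖S‖ + 1`, yields `‖S f‖ ^ 2 ≤ M ⟪S f, f⟫`; the `+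
    -- 1` only guarantees `M > 0`.
    have h1 := hpos ((‖S‖ + 1) • f - S f)
    have h2 : ⟪S (S f), S f⟫ ≤ (‖S‖ + 1) * ‖S f‖ ^ 2 := by
      refine (real_inner_le_norm _ _).trans ?_
      nlinarith [S.le_opNorm (S f), norm_nonneg (S f), sq_nonneg ‖S f‖]
    have h3 : ⟪S (S f), f⟫ = ‖S f‖ ^ 2 := by rw [hsymm, real_inner_self_eq_norm_sq]
    simp only [map_sub, map_smul, inner_sub_left, inner_sub_right, inner_smul_left,
      inner_smul_right, h3, real_inner_self_eq_norm_sq, conj_trivial] at h1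
    have h4 : 0 ≤ (‖S‖ + 1) * ((‖S‖ + 1) * ⟪S f, f⟫ - ‖S f‖ ^ 2) := by linarith
    linarith [nonneg_of_mul_nonneg_right h4 hM]
  have hinv : ∀ f, ‖f‖ ^ 2 ≤ (‖S'‖ + 1) ^ 2 * (‖S‖ + 1) * ⟪S f, f⟫ := fun f => by
    have h1 : S' (S f) = f := by
      rw [← mul_apply_eq_comp, hS', one_apply_eq_self]
    have h2 : ‖f‖ ≤ (‖S'‖ + 1) * ‖S f‖ := by
      have := S'.le_opNorm (S f)
      rw [h1] at this
      nlinarith [norm_nonneg (S f)]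
    calc ‖f‖ ^ 2 ≤ ((‖S'‖ + 1) * ‖S f‖) ^ 2 := by gcongr
      _ = (‖S'‖ + 1) ^ 2 * ‖S f‖ ^ 2 := by ring
      _ ≤ (‖S'‖ + 1) ^ 2 * ((‖S‖ + 1) * ⟪S f, f⟫) := by gcongr; exact hquad f
      _ = _ := by ring
  set Q := (‖S'‖ + 1) ^ 2 * (‖S‖ + 1)
  have hQ : 0 < Q := by positivity
  have hbig : m + 1 / Q ∈ A := fun f => by
    have h1 := hinv f
    rw [hSi, mul_comm, ← div_le_iff₀ hQ] at h1
    have h2 : (m + 1 / Q) * ‖f‖ ^ 2 = m * ‖f‖ ^ 2 + ‖f‖ ^ 2 / Q := by ring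
    linarith
  have := le_csSup hbdd hbig
  have : 0 < 1 / Q := by positivity
  linarith

end Spectrum

/-! ### The heat flow on `ℓ²` -/

section HeatFlow

variable {V : Type*} {G : SimpleGraph V} [G.LocallyFinite] {K : ℕ} (hK : ∀ x, G.degree x ≤ K)

theorem l2Spectrum_eq : l2Spectrum G = spectrum ℝ ((K : ℝ) • 1 - lazyOp hK) := by
  have key : ∀ (f : L2 V) (x : V),
      ((K : ℝ) • (1 : L2 V →L[ℝ] L2 V) - lazyOp hK) f x = -laplacian G (fun y => f y) x := by
    intro f x
    rw [laplacian_eq_lazySum (K := K), neg_sub]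
    rfl
  ext l
  constructor
  · rintro ⟨T, hT, hl⟩
    have : T = (K : ℝ) • (1 : L2 V →L[ℝ] L2 V) - lazyOp hK := by
      ext f x
      rw [hT, key]
    rwa [← this]
  · exact fun hl => ⟨_, key, hl⟩

theorem inner_negLaplacian (f : L2 V) :
    ⟪((K : ℝ) • (1 : L2 V →L[ℝ] L2 V) - lazyOp hK) f, f⟫ = K * ‖f‖ ^ 2 - ⟪lazyOp hK f, f⟫ := by
  simp [inner_sub_left, inner_smul_left]

instance [Nonempty V] : Nontrivial (L2 V) := by
  classical
  obtain ⟨x⟩ := ‹Nonempty V›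
  refine ⟨lp.single 2 x (1 : ℝ), 0, fun h => ?_⟩
  have := congrArg (fun f : L2 V => f x) h
  simp at this

include hK in
theorem le_lambdaOne [Nonempty V] {c : ℝ} (hc : ∀ f : L2 V, ⟪lazyOp hK f, f⟫ ≤ (K - c) * ‖f‖ ^ 2) :
    c ≤ lambdaOne G ∧
      ∀ f : L2 V, ⟪lazyOp hK f, f⟫ ≤ (K - lambdaOne G) * ‖f‖ ^ 2 := by
  have hlow : ∀ f : L2 V,
      c * ‖f‖ ^ 2 ≤ ⟪((K : ℝ) • (1 : L2 V →L[ℝ] L2 V) - lazyOp hK) f, f⟫ := fun f => by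
    rw [inner_negLaplacian]
    linarith [hc f]
  obtain ⟨m, hm, hm'⟩ := exists_lower_bound_mem_spectrum (fun f g => by
    simp [inner_sub_left, inner_sub_right, inner_smul_left, inner_smul_right,
      inner_lazyOp_comm]) hlow
  have hlb : c ∈ lowerBounds (l2Spectrum G) := fun l hl => by
    rw [l2Spectrum_eq hK] at hl
    exact le_of_mem_spectrum hlow hl
  rw [← l2Spectrum_eq hK] at hm
  refine ⟨le_csInf ⟨m, hm⟩ hlb, fun f => ?_⟩
  have h1 := hm' f
  rw [inner_negLaplacian] at h1
  -- The form bound `m` is a spectral point, so it dominates the infimum and the bound survives with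
  -- `λ₁` in its place.
  have h2 : lambdaOne G ≤ m := csInf_le ⟨c, hlb⟩ hm
  nlinarith [sq_nonneg ‖f‖]

/-- The heat semigroup `exp (t Δ)` on `ℓ²(V)`. -/
def heatFlow (t : ℝ) (f : L2 V) : L2 V :=
  Real.exp (-(K * t)) • NormedSpace.exp (t • lazyOp hK) f

theorem heatFlow_zero (f : L2 V) : heatFlow hK 0 f = f := by
  simp [heatFlow]

theorem hasDerivAt_exp_lazyOp (f : L2 V) (t : ℝ) :
    HasDerivAt (fun s : ℝ => NormedSpace.exp (s • lazyOp hK) f)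
      (lazyOp hK (NormedSpace.exp (t • lazyOp hK) f)) t := by
  have h := hasDerivAt_exp_smul_const' (𝕂 := ℝ) (lazyOp hK) t
  exact h.clm_apply (hasDerivAt_const t f) |>.congr_deriv (by simp)

theorem hasDerivAt_heatFlow (f : L2 V) (t : ℝ) :
    HasDerivAt (fun s => heatFlow hK s f)
      (lazyOp hK (heatFlow hK t f) - (K : ℝ) • heatFlow hK t f) t := by
  have h1 : HasDerivAt (fun s : ℝ => Real.exp (-(K * s))) (Real.exp (-(K * t)) * -(K : ℝ)) t := by
    simpa using (((hasDerivAt_id t).const_mul (K : ℝ)).neg).exp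
  refine (h1.smul (hasDerivAt_exp_lazyOp hK f t)).congr_deriv ?_
  simp only [heatFlow, map_smul, smul_smul]
  module

theorem hasDerivAt_heatFlow_apply (f : L2 V) (x : V) (t : ℝ) :
    HasDerivAt (fun s => heatFlow hK s f x) (laplacian G (fun y => heatFlow hK t f y) x) t := by
  have h := (lp.evalCLM (𝕜 := ℝ) (E := fun _ : V => ℝ) (p := 2) x).hasFDerivAt.comp_hasDerivAt t
    (hasDerivAt_heatFlow hK f t)
  refine h.congr_deriv ?_
  rw [laplacian_eq_lazySum (K := K)]
  rfl

theorem contDiff_heatFlow_apply (f : L2 V) (x : V) : ContDiff ℝ 1 fun t => heatFlow hK t f x := by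
  rw [contDiff_one_iff_deriv]
  refine ⟨fun t => (hasDerivAt_heatFlow_apply hK f x t).differentiableAt, ?_⟩
  have : deriv (fun t => heatFlow hK t f x) = fun t => laplacian G (fun y => heatFlow hK t f y) x :=
    funext fun t => (hasDerivAt_heatFlow_apply hK f x t).deriv
  rw [this]
  simp only [laplacian_eq]
  have hc : ∀ y, Continuous fun t => heatFlow hK t f y := fun y =>
    continuous_iff_continuousAt.mpr fun t => (hasDerivAt_heatFlow_apply hK f y t).continuousAt
  fun_prop

/-- Energy method: the form bound makes `exp (2 l t) ‖u(t)‖ ^ 2` nonincreasing. -/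
theorem norm_heatFlow_le {l : ℝ} (hl : ∀ f : L2 V, ⟪lazyOp hK f, f⟫ ≤ (K - l) * ‖f‖ ^ 2)
    (f : L2 V) {t : ℝ} (ht : 0 ≤ t) : ‖heatFlow hK t f‖ ≤ Real.exp (-(l * t)) * ‖f‖ := by
  have h1 : ∀ s, HasDerivAt (fun s => Real.exp (2 * l * s) * ‖heatFlow hK s f‖ ^ 2)
      (Real.exp (2 * l * s) * (2 * l) * ‖heatFlow hK s f‖ ^ 2 + Real.exp (2 * l * s) *
        (2 * ⟪heatFlow hK s f, lazyOp hK (heatFlow hK s f) - (K : ℝ) • heatFlow hK s f⟫)) s := by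
    intro s
    have h1 : HasDerivAt (fun s : ℝ => Real.exp (2 * l * s)) (Real.exp (2 * l * s) * (2 * l)) s := by
      simpa using ((hasDerivAt_id s).const_mul (2 * l)).exp
    exact h1.mul (hasDerivAt_heatFlow hK f s).norm_sq
  have h2 : Antitone fun s => Real.exp (2 * l * s) * ‖heatFlow hK s f‖ ^ 2 := by
    refine antitone_of_deriv_nonpos (fun s => (h1 s).differentiableAt) fun s => ?_
    rw [(h1 s).deriv, inner_sub_right, inner_smul_right, real_inner_self_eq_norm_sq,
      real_inner_comm]
    have := mul_le_mul_of_nonneg_left (hl (heatFlow hK s f)) (Real.exp_pos (2 * l * s)).le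
    nlinarith
  have h3 := h2 ht
  simp only [mul_zero, Real.exp_zero, one_mul, heatFlow_zero] at h3
  refine le_of_sq_le_sq ?_ (by positivity)
  have h4 : Real.exp (-(l * t)) ^ 2 * Real.exp (2 * l * t) = 1 := by
    rw [← Real.exp_nat_mul, ← Real.exp_add]
    ring_nf
    simp
  calc ‖heatFlow hK t f‖ ^ 2
      = Real.exp (-(l * t)) ^ 2 * (Real.exp (2 * l * t) * ‖heatFlow hK t f‖ ^ 2) := by
        rw [← mul_assoc, h4, one_mul]
    _ ≤ Real.exp (-(l * t)) ^ 2 * ‖f‖ ^ 2 := by gcongr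
    _ = _ := by ring

end HeatFlow

end ModelTree
end

/-! ### Positivity, minimality and decay of the heat kernel -/

noncomputable section

namespace ModelTree

open Set Filter Topology
open scoped RealInnerProductSpace Nat

variable {V : Type*} {G : SimpleGraph V} [G.LocallyFinite] {K : ℕ} (hK : ∀ x, G.degree x ≤ K)

theorem hasSum_exp_lazyOp_apply (f : L2 V) (x : V) (t : ℝ) :
    HasSum (fun n : ℕ => t ^ n / n ! * (lazyOp hK ^ n) f x)
      (NormedSpace.exp (t • lazyOp hK) f x) := by
  have h := NormedSpace.exp_series_hasSum_exp' (𝕂 := ℝ) (t • lazyOp hK)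
  have h2 := (h.mapL (ContinuousLinearMap.apply ℝ (L2 V) f)).mapL
    (lp.evalCLM (𝕜 := ℝ) (E := fun _ : V => ℝ) (p := 2) x)
  refine h2.congr_fun fun n => ?_
  simp only [smul_pow, map_smul]
  rw [smul_eq_mul, smul_eq_mul, ← mul_assoc, div_eq_inv_mul]
  rfl

theorem lazyOp_pow_apply_nonneg {f : L2 V} (hf : ∀ x, 0 ≤ f x) (n : ℕ) (x : V) :
    0 ≤ (lazyOp hK ^ n) f x := by
  induction n generalizing x with
  | zero => exact hf x
  | succ n ih =>
    rw [pow_succ', mul_apply_eq_comp, lazyOp_apply]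
    have h := lazySum_mono hK (f := fun _ => 0) ih x
    simpa [lazySum] using h

/-- All terms of the exponential series are nonnegative, so it dominates its zeroth term. This is
the source of strict positivity of the supersolution. -/
theorem le_heatFlow_apply {f : L2 V} (hf : ∀ x, 0 ≤ f x) (x : V) {t : ℝ} (ht : 0 ≤ t) :
    Real.exp (-(K * t)) * f x ≤ heatFlow hK t f x := by
  have h := hasSum_exp_lazyOp_apply hK f x t
  have h1 := h.summable.sum_le_tsum (Finset.range 1) fun n _ =>
    mul_nonneg (by positivity) (lazyOp_pow_apply_nonneg hK hf n x)
  rw [h.tsum_eq] at h1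
  exact mul_le_mul_of_nonneg_left (by simpa using h1) (Real.exp_pos _).le

/-- Partial sums of the exponential series of `Δ + K`. -/
def expPartial (f : L2 V) (n : ℕ) (x : V) (t : ℝ) : ℝ :=
  ∑ i ∈ Finset.range n, t ^ i / i ! * (lazyOp hK ^ i) f x

/-- The index shift under differentiation is what drives the induction in the minimality proof. -/
theorem hasDerivAt_expPartial (f : L2 V) (n : ℕ) (x : V) (t : ℝ) :
    HasDerivAt (expPartial hK f (n + 1) x) (lazySum G K (fun y => expPartial hK f n y t) x) t := by
  have hsum : lazySum G K (fun y => expPartial hK f n y t) x =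
      ∑ i ∈ Finset.range n, t ^ i / i ! * (lazyOp hK ^ (i + 1)) f x := by
    simp only [pow_succ' (lazyOp hK), mul_apply_eq_comp, lazyOp_apply, lazySum, expPartial,
      mul_add, Finset.sum_add_distrib, Finset.mul_sum]
    rw [Finset.sum_comm]
    congr 1
    exact Finset.sum_congr rfl fun i _ => by ring
  have hd : ∀ i ∈ Finset.range (n + 1), HasDerivAt
      (fun s : ℝ => s ^ i / i ! * (lazyOp hK ^ i) f x)
      (i * t ^ (i - 1) / i ! * (lazyOp hK ^ i) f x) t := fun i _ =>
    ((hasDerivAt_pow i t).div_const _).mul_const _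
  refine (HasDerivAt.fun_sum hd).congr_deriv ?_
  rw [hsum, Finset.sum_range_succ']
  simp only [Nat.cast_zero, zero_mul, zero_div, add_zero]
  refine Finset.sum_congr rfl fun i _ => ?_
  rw [Nat.factorial_succ, Nat.add_sub_cancel]
  push_cast
  field_simp

theorem expPartial_succ_zero (f : L2 V) (n : ℕ) (x : V) : expPartial hK f (n + 1) x 0 = f x := by
  rw [expPartial, Finset.sum_range_succ']
  simp

/-- Every nonnegative solution of the heat equation dominates the heat flow of its initial
datum. -/
theorem heatFlow_apply_le {f : L2 V} {w : V → ℝ → ℝ} (hreg : ∀ x, TimeRegular (w x))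
    (heq : ∀ x, ∀ t, 0 < t → deriv (w x) t - laplacian G (fun y => w y t) x = 0)
    (hinit : ∀ x, w x 0 = f x) (hnonneg : ∀ x, ∀ t, 0 ≤ t → 0 ≤ w x t) (x : V) {t : ℝ}
    (ht : 0 ≤ t) : heatFlow hK t f x ≤ w x t := by
  -- The function `exp (K t) w` solves `v' = A v` with `A = Δ + K` order preserving, so a bound for
  -- one partial sum integrates to a bound for the next; no maximum principle is needed.
  have key : ∀ n x, ∀ t, 0 ≤ t → expPartial hK f n x t ≤ Real.exp (K * t) * w x t := by
    intro n
    induction n with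
    | zero =>
      intro x t ht
      simpa [expPartial] using mul_nonneg (Real.exp_pos _).le (hnonneg x t ht)
    | succ n ih =>
      intro x t ht
      have hd : ∀ s, 0 < s → HasDerivAt
          (fun s => Real.exp (K * s) * w x s - expPartial hK f (n + 1) x s)
          (Real.exp (K * s) * K * w x s + Real.exp (K * s) * deriv (w x) s -
            lazySum G K (fun y => expPartial hK f n y s) x) s := by
        intro s hs
        have h1 : HasDerivAt (fun s : ℝ => Real.exp (K * s)) (Real.exp (K * s) * K) s := by
          simpa using ((hasDerivAt_id s).const_mul (K : ℝ)).exp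
        have h2 : DifferentiableAt ℝ (w x) s :=
          ((hreg x).2.differentiableOn (by simp)).differentiableAt (Ioi_mem_nhds hs)
        exact (h1.mul h2.hasDerivAt).sub (hasDerivAt_expPartial hK f n x s)
      have hmono : MonotoneOn (fun s => Real.exp (K * s) * w x s - expPartial hK f (n + 1) x s)
          (Ici 0) := by
        refine monotoneOn_of_deriv_nonneg (convex_Ici 0) ?_ ?_ ?_
        · refine ContinuousOn.sub (ContinuousOn.mul (by fun_prop) (hreg x).1) ?_
          exact fun s _ => (hasDerivAt_expPartial hK f n x s).continuousAt.continuousWithinAt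
        · rw [interior_Ici]
          exact fun s hs => (hd s hs).differentiableAt.differentiableWithinAt
        · rw [interior_Ici]
          intro s hs
          rw [(hd s hs).deriv]
          have h1 := heq x s hs
          rw [laplacian_eq_lazySum (K := K)] at h1
          have h2 : lazySum G K (fun y => expPartial hK f n y s) x ≤
              lazySum G K (fun y => Real.exp (K * s) * w y s) x :=
            lazySum_mono hK (fun y => ih y s (le_of_lt hs)) x
          have h3 : lazySum G K (fun y => Real.exp (K * s) * w y s) x =
              Real.exp (K * s) * lazySum G K (fun y => w y s) x := by
            simp only [lazySum, ← Finset.mul_sum]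
            ring
          have h4 : deriv (w x) s = lazySum G K (fun y => w y s) x - K * w x s := by linarith
          rw [h4]
          nlinarith
      have h := hmono self_mem_Ici ht ht
      simp only [mul_zero, Real.exp_zero, one_mul, hinit, expPartial_succ_zero, sub_self] at h
      linarith
  have h := hasSum_exp_lazyOp_apply hK f x t
  have hle := le_of_tendsto' h.tendsto_sum_nat fun n => key n x t ht
  calc heatFlow hK t f x = Real.exp (-(K * t)) * NormedSpace.exp (t • lazyOp hK) f x := rfl
    _ ≤ Real.exp (-(K * t)) * (Real.exp (K * t) * w x t) := by gcongr
    _ = w x t := by rw [← mul_assoc, ← Real.exp_add]; simp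

open Classical in
/-- The unit mass at `y`, as an element of `ℓ²(V)`. -/
def unitMass (y : V) : L2 V := lp.single 2 y (1 : ℝ)

open Classical in
theorem unitMass_apply (x y : V) : unitMass y x = if x = y then 1 else 0 := by
  simp [unitMass, Pi.single_apply]

theorem unitMass_nonneg (x y : V) : 0 ≤ unitMass y x := by
  classical
  rw [unitMass_apply]
  split_ifs <;> simp

theorem norm_unitMass (y : V) : ‖unitMass y‖ = 1 := by
  simp [unitMass, lp.norm_single]

theorem timeRegular_heatFlow (f : L2 V) (x : V) : TimeRegular fun t => heatFlow hK t f x :=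
  ⟨(contDiff_heatFlow_apply hK f x).continuous.continuousOn,
    (contDiff_heatFlow_apply hK f x).contDiffOn⟩

theorem heatFlow_nonneg {f : L2 V} (hf : ∀ x, 0 ≤ f x) (x : V) {t : ℝ} (ht : 0 ≤ t) :
    0 ≤ heatFlow hK t f x :=
  (mul_nonneg (Real.exp_pos _).le (hf x)).trans (le_heatFlow_apply hK hf x ht)

theorem isFundamentalSolution_heatFlow :
    IsFundamentalSolution G fun x y t => heatFlow hK t (unitMass y) x where
  regular x y := timeRegular_heatFlow hK _ x
  equation x y t _ := by rw [(hasDerivAt_heatFlow_apply hK _ x t).deriv, sub_self]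
  initial x y := by rw [heatFlow_zero, unitMass_apply]
  nonneg x y t ht := heatFlow_nonneg hK (fun x => unitMass_nonneg x y) x ht

theorem heatKernel_eq (x y : V) {t : ℝ} (ht : 0 ≤ t) :
    heatKernel G x y t = heatFlow hK t (unitMass y) x := by
  refine IsLeast.csInf_eq ⟨⟨_, isFundamentalSolution_heatFlow hK, rfl⟩, ?_⟩
  rintro _ ⟨q, hq, rfl⟩
  refine heatFlow_apply_le hK (w := fun x t => q x y t) (fun x => hq.regular x y)
    (fun x => hq.equation x y) (fun x => ?_) (fun x => hq.nonneg x y) x ht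
  rw [hq.initial, unitMass_apply]

theorem hasSum_heatFlow (f : L2 V) (x : V) (t : ℝ) :
    HasSum (fun y => heatFlow hK t (unitMass y) x * f y) (heatFlow hK t f x) := by
  classical
  have h := lp.hasSum_single (p := 2) (by simp) f
  have h2 := (h.mapL (Real.exp (-(K * t)) • NormedSpace.exp (t • lazyOp hK))).mapL
    (lp.evalCLM (𝕜 := ℝ) (E := fun _ : V => ℝ) (p := 2) x)
  refine h2.congr_fun fun y => ?_
  have h3 : lp.single 2 y (f y) = f y • unitMass y := by
    rw [unitMass]
    convert lp.single_smul (E := fun _ : V => ℝ) 2 y (f y) (1 : ℝ) using 2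
    simp
  rw [h3, map_smul, map_smul, smul_eq_mul, mul_comm]
  rfl

theorem heatSemigroup_eq (f : L2 V) (x : V) {t : ℝ} (ht : 0 ≤ t) :
    heatSemigroup G t (fun y => f y) x = heatFlow hK t f x := by
  simp only [heatSemigroup, heatKernel_eq hK x _ ht]
  exact (hasSum_heatFlow hK f x t).tsum_eq

/-- Unit masses have norm one, so the `ℓ²` decay bounds every kernel entry by `exp (-(l * t))`. -/
theorem heatFlow_apply_le_l1 {l : ℝ} (hl : ∀ f : L2 V, ⟪lazyOp hK f, f⟫ ≤ (K - l) * ‖f‖ ^ 2)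
    {f : L2 V} (hf : ∀ x, 0 ≤ f x) (hs : Summable fun x => f x) (x : V) {t : ℝ} (ht : 0 ≤ t) :
    heatFlow hK t f x ≤ Real.exp (-(l * t)) * ∑' x, f x := by
  refine hasSum_le (fun y => ?_) (hasSum_heatFlow hK f x t) (hs.hasSum.mul_left _)
  refine mul_le_mul_of_nonneg_right ?_ (hf y)
  refine ((le_abs_self _).trans (L2.abs_apply_le _ x)).trans ?_
  simpa [norm_unitMass] using norm_heatFlow_le hK hl (unitMass y) ht

theorem memℓp_two_of_summable {v : V → ℝ} (hs : Summable v) : Memℓp v 2 := by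
  refine Memℓp.of_exponent_ge (q := 1) ((memℓp_gen_iff (by simp)).mpr ?_) (by norm_num)
  simpa using hs.abs

end ModelTree
end

/-! ### Monotone iteration below a supersolution -/

noncomputable section

namespace ModelTree

open Set Filter Topology MeasureTheory

variable {V : Type*} (G : SimpleGraph V) [G.LocallyFinite] (K : ℕ) (p : ℝ)

/-- The nonnegative part `exp (K t) ((Δ + K) w + w ^ p)` of the right-hand side, after
multiplication of the equation with the integrating factor `exp (K t)`. -/
def sourceTerm (w : V → ℝ → ℝ) (x : V) (t : ℝ) : ℝ :=
  Real.exp (K * t) * (lazySum G K (fun y => w y t) x + w x t ^ p)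

/-- The integral operator whose fixed points solve `u_t - Δ u = u ^ p`, `u = u₀` at time `0`. -/
def duhamel (u₀ : V → ℝ) (w : V → ℝ → ℝ) (x : V) (t : ℝ) : ℝ :=
  Real.exp (-(K * t)) * (u₀ x + ∫ s in (0 : ℝ)..t, sourceTerm G K p w x s)

/-- Monotone iteration of the integral operator, started at `0`. -/
def picard (u₀ : V → ℝ) : ℕ → V → ℝ → ℝ
  | 0 => fun _ _ => 0
  | n + 1 => duhamel G K p u₀ (picard u₀ n)

variable {G K p}

theorem sourceTerm_mono (hK : ∀ x, G.degree x ≤ K) (hp : 0 ≤ p) {w w' : V → ℝ → ℝ} {t : ℝ}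
    (h0 : ∀ y, 0 ≤ w y t) (h : ∀ y, w y t ≤ w' y t) (x : V) :
    sourceTerm G K p w x t ≤ sourceTerm G K p w' x t :=
  mul_le_mul_of_nonneg_left (add_le_add (lazySum_mono hK h x)
    (Real.rpow_le_rpow (h0 x) (h x) hp)) (Real.exp_pos _).le

theorem sourceTerm_zero (hp : 0 < p) (x : V) (t : ℝ) :
    sourceTerm G K p (fun _ _ => 0) x t = 0 := by
  simp [sourceTerm, lazySum, Real.zero_rpow hp.ne']

theorem sourceTerm_nonneg (hK : ∀ x, G.degree x ≤ K) (hp : 0 < p) {w : V → ℝ → ℝ} {t : ℝ}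
    (h0 : ∀ y, 0 ≤ w y t) (x : V) : 0 ≤ sourceTerm G K p w x t := by
  rw [← sourceTerm_zero (G := G) (K := K) hp x t]
  exact sourceTerm_mono hK hp.le (fun _ => le_rfl) h0 x

theorem sourceTerm_le (hK : ∀ x, G.degree x ≤ K) (hp : 0 < p) {w : V → ℝ → ℝ} {t τ C : ℝ}
    (ht : t ≤ τ) (h0 : ∀ y, 0 ≤ w y t) (h : ∀ y, w y t ≤ C) (x : V) :
    sourceTerm G K p w x t ≤ Real.exp (K * τ) * (K * C + C ^ p) := by
  have hC : 0 ≤ C := (h0 x).trans (h x)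
  refine (sourceTerm_mono hK hp.le (w' := fun _ _ => C) h0 h x).trans ?_
  have : lazySum G K (fun _ => C) x = K * C := by
    simp [lazySum]
    ring
  rw [sourceTerm, this]
  gcongr

theorem continuous_sourceTerm (hp : 0 ≤ p) {w : V → ℝ → ℝ} (hw : ∀ x, Continuous (w x)) (x : V) :
    Continuous (sourceTerm G K p w x) := by
  unfold sourceTerm lazySum
  have := (hw x).rpow_const (p := p) fun _ => .inr hp
  fun_prop

/-- The correction `K * (w - duhamel w)` vanishes at a fixed point, leaving the original equation.
-/
theorem hasDerivAt_duhamel (hp : 0 ≤ p) (u₀ : V → ℝ) {w : V → ℝ → ℝ}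
    (hw : ∀ x, Continuous (w x)) (x : V) (t : ℝ) :
    HasDerivAt (duhamel G K p u₀ w x)
      (laplacian G (fun y => w y t) x + K * (w x t - duhamel G K p u₀ w x t) + w x t ^ p) t := by
  have hc := continuous_sourceTerm (G := G) (K := K) hp hw x
  have h1 : HasDerivAt (fun s : ℝ => Real.exp (-(K * s))) (Real.exp (-(K * t)) * -(K : ℝ)) t := by
    simpa using (((hasDerivAt_id t).const_mul (K : ℝ)).neg).exp
  have h2 := (hc.integral_hasStrictDerivAt 0 t).hasDerivAt.const_add (u₀ x)
  refine (h1.mul h2).congr_deriv ?_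
  have h3 : Real.exp (-(K * t)) * Real.exp (K * t) = 1 := by
    rw [← Real.exp_add]
    simp
  rw [laplacian_eq_lazySum (K := K), sourceTerm, ← mul_assoc, h3, duhamel]
  ring

theorem continuous_picard (hp : 0 ≤ p) (u₀ : V → ℝ) (n : ℕ) (x : V) :
    Continuous (picard G K p u₀ n x) := by
  induction n generalizing x with
  | zero => exact continuous_const
  | succ n ih =>
    exact continuous_iff_continuousAt.mpr fun t => (hasDerivAt_duhamel hp u₀ ih x t).continuousAt

/-- Multiplied by `exp (K t)`, the supersolution inequality says that `exp (K t) U` grows at least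
as fast as the integral of the source of `w`. -/
theorem duhamel_le_supersolution (hK : ∀ x, G.degree x ≤ K) (hp : 0 ≤ p) {u₀ : V → ℝ}
    {w U : V → ℝ → ℝ} (hw : ∀ x, Continuous (w x)) (hU : IsGlobalSupersolution G p U)
    (hu₀ : ∀ x, u₀ x ≤ U x 0) (h0 : ∀ x t, 0 ≤ t → 0 ≤ w x t)
    (hwU : ∀ x t, 0 ≤ t → w x t ≤ U x t) (x : V) {t : ℝ} (ht : 0 ≤ t) :
    duhamel G K p u₀ w x t ≤ U x t := by
  have hc := continuous_sourceTerm (G := G) (K := K) hp hw x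
  have hd : ∀ s, 0 < s → HasDerivAt
      (fun s => Real.exp (K * s) * U x s - (u₀ x + ∫ r in (0 : ℝ)..s, sourceTerm G K p w x r))
      (Real.exp (K * s) * K * U x s + Real.exp (K * s) * deriv (U x) s -
        sourceTerm G K p w x s) s := by
    intro s hs
    have h1 : HasDerivAt (fun s : ℝ => Real.exp (K * s)) (Real.exp (K * s) * K) s := by
      simpa using ((hasDerivAt_id s).const_mul (K : ℝ)).exp
    have h2 : DifferentiableAt ℝ (U x) s :=
      ((hU.regular x).2.differentiableOn (by simp)).differentiableAt (Ioi_mem_nhds hs)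
    exact (h1.mul h2.hasDerivAt).sub
      ((hc.integral_hasStrictDerivAt 0 s).hasDerivAt.const_add (u₀ x))
  have hmono : MonotoneOn (fun s => Real.exp (K * s) * U x s -
      (u₀ x + ∫ r in (0 : ℝ)..s, sourceTerm G K p w x r)) (Ici 0) := by
    refine monotoneOn_of_deriv_nonneg (convex_Ici 0) ?_ ?_ ?_
    · refine ContinuousOn.sub (ContinuousOn.mul (by fun_prop) (hU.regular x).1) ?_
      exact fun s _ => ((hc.integral_hasStrictDerivAt 0 s).hasDerivAt.const_add
        (u₀ x)).continuousAt.continuousWithinAt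
    · rw [interior_Ici]
      exact fun s hs => (hd s hs).differentiableAt.differentiableWithinAt
    · rw [interior_Ici]
      intro s hs
      rw [(hd s hs).deriv]
      have h1 := hU.inequality x s hs
      rw [laplacian_eq_lazySum (K := K)] at h1
      have h2 := sourceTerm_mono hK hp (fun y => h0 y s (le_of_lt hs))
        (fun y => hwU y s (le_of_lt hs)) x
      have h3 : sourceTerm G K p U x s ≤ Real.exp (K * s) * (deriv (U x) s + K * U x s) := by
        unfold sourceTerm
        exact mul_le_mul_of_nonneg_left (by linarith) (Real.exp_pos _).le
      linarith
  have h := hmono self_mem_Ici ht ht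
  simp only [mul_zero, Real.exp_zero, one_mul, intervalIntegral.integral_same, add_zero] at h
  have h5 : u₀ x + ∫ s in (0 : ℝ)..t, sourceTerm G K p w x s ≤ Real.exp (K * t) * U x t := by
    linarith [hu₀ x]
  calc duhamel G K p u₀ w x t ≤ Real.exp (-(K * t)) * (Real.exp (K * t) * U x t) := by
        unfold duhamel
        gcongr
    _ = U x t := by rw [← mul_assoc, ← Real.exp_add]; simp

theorem duhamel_mono (hK : ∀ x, G.degree x ≤ K) (hp : 0 ≤ p) (u₀ : V → ℝ) {w w' : V → ℝ → ℝ}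
    (hw : ∀ x, Continuous (w x)) (hw' : ∀ x, Continuous (w' x)) (h0 : ∀ x t, 0 ≤ t → 0 ≤ w x t)
    (h : ∀ x t, 0 ≤ t → w x t ≤ w' x t) (x : V) {t : ℝ} (ht : 0 ≤ t) :
    duhamel G K p u₀ w x t ≤ duhamel G K p u₀ w' x t := by
  unfold duhamel
  gcongr
  refine intervalIntegral.integral_mono_on ht
    ((continuous_sourceTerm hp hw x).intervalIntegrable _ _)
    ((continuous_sourceTerm hp hw' x).intervalIntegrable _ _) fun s hs => ?_
  exact sourceTerm_mono hK hp (fun y => h0 y s hs.1) (fun y => h y s hs.1) x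

theorem duhamel_nonneg (hK : ∀ x, G.degree x ≤ K) (hp : 0 < p) {u₀ : V → ℝ}
    (hu₀ : ∀ x, 0 ≤ u₀ x) {w : V → ℝ → ℝ} (h0 : ∀ x t, 0 ≤ t → 0 ≤ w x t) (x : V) {t : ℝ}
    (ht : 0 ≤ t) : 0 ≤ duhamel G K p u₀ w x t :=
  mul_nonneg (Real.exp_pos _).le (add_nonneg (hu₀ x) (intervalIntegral.integral_nonneg ht
    fun s hs => sourceTerm_nonneg hK hp (fun y => h0 y s hs.1) x))

theorem picard_nonneg (hK : ∀ x, G.degree x ≤ K) (hp : 0 < p) {u₀ : V → ℝ}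
    (hu₀ : ∀ x, 0 ≤ u₀ x) (n : ℕ) : ∀ x t, 0 ≤ t → 0 ≤ picard G K p u₀ n x t := by
  induction n with
  | zero => exact fun _ _ _ => le_rfl
  | succ n ih => exact fun x t ht => duhamel_nonneg hK hp hu₀ ih x ht

theorem picard_le_succ (hK : ∀ x, G.degree x ≤ K) (hp : 0 < p) {u₀ : V → ℝ}
    (hu₀ : ∀ x, 0 ≤ u₀ x) (n : ℕ) :
    ∀ x t, 0 ≤ t → picard G K p u₀ n x t ≤ picard G K p u₀ (n + 1) x t := by
  induction n with
  | zero => exact picard_nonneg hK hp hu₀ 1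
  | succ n ih =>
    exact fun x t ht => duhamel_mono hK hp.le u₀ (continuous_picard hp.le u₀ n)
      (continuous_picard hp.le u₀ (n + 1)) (picard_nonneg hK hp hu₀ n) ih x ht

theorem picard_le_supersolution (hK : ∀ x, G.degree x ≤ K) (hp : 0 < p) {u₀ : V → ℝ}
    {U : V → ℝ → ℝ} (hU : IsGlobalSupersolution G p U) (hu₀ : ∀ x, 0 ≤ u₀ x ∧ u₀ x ≤ U x 0)
    (n : ℕ) : ∀ x t, 0 ≤ t → picard G K p u₀ n x t ≤ U x t := by
  induction n with
  | zero =>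
    intro x t ht
    rcases ht.eq_or_lt with rfl | ht
    · exact (hu₀ x).1.trans (hu₀ x).2
    · exact hU.nonneg x t ht
  | succ n ih =>
    exact fun x t ht => duhamel_le_supersolution hK hp.le (continuous_picard hp.le u₀ n) hU
      (fun x => (hu₀ x).2) (picard_nonneg hK hp (fun x => (hu₀ x).1) n) ih x ht

/-- A continuous solution of the integral equation is a classical solution. -/
theorem isGlobalSolution_of_eq_duhamel (hp : 0 ≤ p) {u₀ : V → ℝ} {w : V → ℝ → ℝ}
    (hw : ∀ x, Continuous (w x)) (hb : LocallyBounded w) (h0 : ∀ x t, 0 ≤ w x t)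
    (heq : ∀ x t, 0 ≤ t → w x t = duhamel G K p u₀ w x t) : IsGlobalSolution G p u₀ w where
  regular x := by
    refine ⟨(hw x).continuousOn, ContDiffOn.congr (f := duhamel G K p u₀ w x) ?_
      fun t ht => heq x t (le_of_lt ht)⟩
    refine ContDiff.contDiffOn (contDiff_one_iff_deriv.mpr
      ⟨fun t => (hasDerivAt_duhamel hp u₀ hw x t).differentiableAt, ?_⟩)
    rw [show deriv (duhamel G K p u₀ w x) = _ from
      funext fun t => (hasDerivAt_duhamel hp u₀ hw x t).deriv]
    have h1 : Continuous (duhamel G K p u₀ w x) :=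
      continuous_iff_continuousAt.mpr fun t => (hasDerivAt_duhamel hp u₀ hw x t).continuousAt
    have h2 := (hw x).rpow_const (p := p) fun _ => .inr hp
    simp only [laplacian_eq]
    fun_prop
  bounded := hb
  equation x t ht := by
    have h : w x =ᶠ[𝓝 t] duhamel G K p u₀ w x := by
      filter_upwards [Ioi_mem_nhds ht] with s hs using heq x s (le_of_lt hs)
    rw [h.deriv_eq, (hasDerivAt_duhamel hp u₀ hw x t).deriv, ← heq x t ht.le]
    ring
  initial x := by
    rw [heq x 0 le_rfl]
    simp [duhamel]
  nonneg x t _ := h0 x t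

/-- Below a supersolution there is a solution. -/
theorem exists_isGlobalSolution_of_supersolution (hK : ∀ x, G.degree x ≤ K) (hp : 0 < p)
    {u₀ : V → ℝ} {U : V → ℝ → ℝ} (hU : IsGlobalSupersolution G p U)
    (hu₀ : ∀ x, 0 ≤ u₀ x ∧ u₀ x ≤ U x 0) : ∃ u : V → ℝ → ℝ, IsGlobalSolution G p u₀ u := by
  set P := picard G K p u₀
  have hP0 : ∀ n x t, 0 ≤ t → 0 ≤ P n x t := picard_nonneg hK hp fun x => (hu₀ x).1
  have hPU : ∀ n x t, 0 ≤ t → P n x t ≤ U x t := picard_le_supersolution hK hp hU hu₀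
  have hPc : ∀ n x, Continuous (P n x) := continuous_picard hp.le u₀
  -- Freezing negative times at `0` keeps the iterates nonnegative and bounded on all of `ℝ`, so
  -- measurability and continuity can be stated globally.
  set w : V → ℝ → ℝ := fun x t => ⨆ n, P n x (max t 0)
  have hmono : ∀ x t, Monotone fun n => P n x (max t 0) := fun x t =>
    monotone_nat_of_le_succ fun n =>
      picard_le_succ hK hp (fun x => (hu₀ x).1) n x _ (le_max_right _ _)
  have hbdd : ∀ x t, BddAbove (range fun n => P n x (max t 0)) := fun x t =>
    ⟨U x (max t 0), by rintro _ ⟨n, rfl⟩; exact hPU n x _ (le_max_right _ _)⟩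
  have hlim : ∀ x t, Tendsto (fun n => P n x (max t 0)) atTop (𝓝 (w x t)) := fun x t =>
    tendsto_atTop_ciSup (hmono x t) (hbdd x t)
  have hlim' : ∀ x t, 0 ≤ t → Tendsto (fun n => P n x t) atTop (𝓝 (w x t)) := fun x t ht => by
    simpa [max_eq_left ht] using hlim x t
  have hw0 : ∀ x t, 0 ≤ w x t := fun x t =>
    ge_of_tendsto' (hlim x t) fun n => hP0 n x _ (le_max_right _ _)
  have hwU : ∀ x t, w x t ≤ U x (max t 0) := fun x t =>
    le_of_tendsto' (hlim x t) fun n => hPU n x _ (le_max_right _ _)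
  have hwm : ∀ x, Measurable (w x) := fun x => Measurable.iSup fun n =>
    ((hPc n x).comp (continuous_id.max continuous_const)).measurable
  have hsm : ∀ x, Measurable (sourceTerm G K p w x) := fun x => by
    unfold sourceTerm lazySum
    fun_prop
  have hint : ∀ x a b, IntervalIntegrable (sourceTerm G K p w x) volume a b := by
    intro x a b
    obtain ⟨C, hC⟩ := hU.bounded (max (max a b) 1) (by positivity)
    rw [intervalIntegrable_iff]
    refine Measure.integrableOn_of_bounded (M := Real.exp (K * max a b) * (K * C + C ^ p))
      (by simp [uIoc]) (hsm x).aestronglyMeasurable ?_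
    refine (ae_restrict_iff' measurableSet_uIoc).mpr (ae_of_all _ fun s hs => ?_)
    rw [Real.norm_of_nonneg (sourceTerm_nonneg hK hp (fun y => hw0 y s) x)]
    refine sourceTerm_le hK hp hs.2 (fun y => hw0 y s) (fun y => (hwU y s).trans ?_) x
    refine (le_abs_self _).trans (hC y _ ⟨le_max_right _ _, ?_⟩)
    exact max_le (hs.2.trans (le_max_left _ _)) (le_trans zero_le_one (le_max_right _ _))
  -- Dominated convergence: the sources increase to that of `w`, which is itself the integrable
  -- majorant.
  have heq : ∀ x t, 0 ≤ t → w x t = duhamel G K p u₀ w x t := by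
    intro x t ht
    refine tendsto_nhds_unique ((tendsto_add_atTop_iff_nat 1).mpr (hlim' x t ht)) ?_
    refine Tendsto.const_mul _ (Tendsto.const_add _ ?_)
    refine intervalIntegral.tendsto_integral_filter_of_dominated_convergence
      (sourceTerm G K p w x) ?_ ?_ (hint x 0 t) ?_
    · exact .of_forall fun n => (continuous_sourceTerm hp.le (hPc n) x).aestronglyMeasurable
    · refine .of_forall fun n => ae_of_all _ fun s hs => ?_
      rw [uIoc_of_le ht] at hs
      rw [Real.norm_of_nonneg (sourceTerm_nonneg hK hp (fun y => hP0 n y s hs.1.le) x)]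
      refine sourceTerm_mono hK hp.le (fun y => hP0 n y s hs.1.le) (fun y => ?_) x
      simpa [w, max_eq_left hs.1.le] using le_ciSup (hbdd y s) n
    · refine ae_of_all _ fun s hs => ?_
      rw [uIoc_of_le ht] at hs
      have hl : ∀ y, Tendsto (fun n => P n y s) atTop (𝓝 (w y s)) := fun y => hlim' y s hs.1.le
      refine Tendsto.const_mul _ (Tendsto.add ?_ ((hl x).rpow_const (.inr hp.le)))
      exact (tendsto_finsetSum _ fun y _ => hl y).add ((hl x).const_mul _)
  -- A supremum of continuous functions is so far only measurable; continuity comes from the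
  -- integral equation.
  have hwc : ∀ x, Continuous (w x) := fun x => by
    have h1 : Continuous (duhamel G K p u₀ w x) := by
      have := intervalIntegral.continuous_primitive (hint x) 0
      unfold duhamel
      fun_prop
    have h2 : w x = fun t => duhamel G K p u₀ w x (max t 0) := funext fun t => by
      rw [← heq x _ (le_max_right _ _)]
      simp [w]
    rw [h2]
    fun_prop
  refine ⟨w, isGlobalSolution_of_eq_duhamel hp.le hwc (fun τ hτ => ?_) hw0 heq⟩
  obtain ⟨C, hC⟩ := hU.bounded τ hτ
  refine ⟨C, fun x t ht => ?_⟩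
  rw [abs_of_nonneg (hw0 x t)]
  have := hwU x t
  rw [max_eq_left ht.1] at this
  exact this.trans ((le_abs_self _).trans (hC x t ht))

end ModelTree
end

noncomputable section

namespace ModelTree

open Set Filter Topology
open scoped RealInnerProductSpace

/-! ### The explicit supersolution -/

section Supersolution

variable {V : Type*} {G : SimpleGraph V} {p : ℝ} {v₀ : V → ℝ} {t₀ : ℝ}

namespace IsAdmissible

theorem l1Norm_eq (h : IsAdmissible G p v₀ t₀) : l1Norm v₀ = ∑' x, v₀ x := by
  simp only [l1Norm, abs_of_pos (h.pos _)]

theorem l1Norm_pos [Nonempty V] (h : IsAdmissible G p v₀ t₀) : 0 < l1Norm v₀ := by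
  rw [h.l1Norm_eq]
  exact h.summable.tsum_pos (fun x => (h.pos x).le) (Classical.arbitrary V) (h.pos _)

theorem time_pos (h : IsAdmissible G p v₀ t₀) : 0 < t₀ := (le_max_left _ _).trans_lt h.lt_time

variable [Nonempty V] (hp : 1 < p) (hl : 0 < lambdaOne G)
include hl

theorem constD_pos (h : IsAdmissible G p v₀ t₀) : 0 < constD G p v₀ t₀ := by
  have := h.l1Norm_pos
  unfold constD
  positivity

include hp

/-- This is the logarithmic condition on `t₀` after exponentiation. -/
theorem constD_lt_one (h : IsAdmissible G p v₀ t₀) : constD G p v₀ t₀ < 1 := by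
  have hN := h.l1Norm_pos
  have ha : 0 < (p - 1) * lambdaOne G := mul_pos (by linarith) hl
  have h1 := (le_max_right _ _).trans_lt h.lt_time
  rw [one_div_mul_eq_div, div_lt_iff₀ ha] at h1
  have hpos : 0 < 1 / lambdaOne G * l1Norm v₀ ^ (p - 1) := by positivity
  rw [Real.log_lt_iff_lt_exp hpos] at h1
  calc constD G p v₀ t₀
      < Real.exp (t₀ * ((p - 1) * lambdaOne G)) * Real.exp (-(p - 1) * lambdaOne G * t₀) :=
        mul_lt_mul_of_pos_right h1 (Real.exp_pos _)
    _ = 1 := by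
        rw [← Real.exp_add]
        ring_nf
        simp

theorem hBase_pos (h : IsAdmissible G p v₀ t₀) {t : ℝ} :
    0 < 1 - constD G p v₀ t₀ * (1 - Real.exp (-(p - 1) * lambdaOne G * t)) := by
  have h1 := h.constD_pos hl
  have h2 := h.constD_lt_one hp hl
  have h3 := Real.exp_pos (-(p - 1) * lambdaOne G * t)
  nlinarith

theorem hFactor_pos (h : IsAdmissible G p v₀ t₀) (t : ℝ) : 0 < hFactor G p v₀ t₀ t :=
  Real.rpow_pos_of_pos (h.hBase_pos hp hl) _

theorem contDiff_hFactor (h : IsAdmissible G p v₀ t₀) : ContDiff ℝ 1 (hFactor G p v₀ t₀) := by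
  refine ContDiff.rpow_const_of_ne ?_ fun t => (h.hBase_pos hp hl).ne'
  fun_prop

/-- A Bernoulli equation whose coefficient is the `(p - 1)`-st power of the decay bound for `P_{t +
t₀} v₀`. -/
theorem hasDerivAt_hFactor (h : IsAdmissible G p v₀ t₀) (t : ℝ) :
    HasDerivAt (hFactor G p v₀ t₀) (l1Norm v₀ ^ (p - 1) *
      Real.exp (-(p - 1) * lambdaOne G * (t + t₀)) * hFactor G p v₀ t₀ t ^ p) t := by
  have hb := h.hBase_pos hp hl (t := t)
  have hp1 : p - 1 ≠ 0 := by linarith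
  have h1 : HasDerivAt (fun s : ℝ => Real.exp (-(p - 1) * lambdaOne G * s))
      (Real.exp (-(p - 1) * lambdaOne G * t) * (-(p - 1) * lambdaOne G)) t := by
    simpa using ((hasDerivAt_id t).const_mul (-(p - 1) * lambdaOne G)).exp
  have h2 := (((h1.const_sub 1).const_mul (constD G p v₀ t₀)).const_sub 1).rpow_const
    (p := -(1 / (p - 1))) (.inl hb.ne')
  refine h2.congr_deriv ?_
  -- This exponent identity turns the power left by differentiation into `h ^ p`.
  have h3 : -(1 / (p - 1)) - 1 = -(1 / (p - 1)) * p := by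
    field_simp
    ring
  rw [h3, hFactor, ← Real.rpow_mul hb.le, ← mul_assoc]
  congr 1
  have h4 : Real.exp (-(p - 1) * lambdaOne G * (t + t₀)) =
      Real.exp (-(p - 1) * lambdaOne G * t) * Real.exp (-(p - 1) * lambdaOne G * t₀) := by
    rw [← Real.exp_add]
    ring_nf
  rw [h4, constD]
  field_simp

end IsAdmissible

variable [G.LocallyFinite] {K : ℕ} (hK : ∀ x, G.degree x ≤ K)

/-- A summable function, as an element of `ℓ²(V)`. -/
def toL2 {v : V → ℝ} (hv : Summable v) : L2 V := ⟨v, memℓp_two_of_summable hv⟩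

theorem superSol_eq (h : IsAdmissible G p v₀ t₀) (x : V) {t : ℝ} (ht : -t₀ ≤ t) :
    superSol G p v₀ t₀ x t = hFactor G p v₀ t₀ t * heatFlow hK (t + t₀) (toL2 h.summable) x := by
  rw [superSol, ← heatSemigroup_eq hK _ x (by linarith)]
  rfl

variable [Nonempty V]
include hK

theorem superSol_pos (hp : 1 < p) (hl : 0 < lambdaOne G) (h : IsAdmissible G p v₀ t₀) (x : V)
    {t : ℝ} (ht : 0 ≤ t) : 0 < superSol G p v₀ t₀ x t := by
  have h0 := h.time_pos
  rw [superSol_eq hK h x (by linarith)]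
  refine mul_pos (h.hFactor_pos hp hl t) (lt_of_lt_of_le
    (mul_pos (Real.exp_pos _) (h.pos x)) (le_heatFlow_apply hK (f := toL2 h.summable)
    (fun x => (h.pos x).le) x (by linarith)))

theorem isGlobalSupersolution_superSol (hp : 1 < p) (hl : 0 < lambdaOne G)
    (hgap : ∀ f : L2 V, ⟪lazyOp hK f, f⟫ ≤ (K - lambdaOne G) * ‖f‖ ^ 2)
    (h : IsAdmissible G p v₀ t₀) : IsGlobalSupersolution G p (superSol G p v₀ t₀) := by
  have h0 := h.time_pos
  set f := toL2 h.summable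
  have hle : ∀ x t, 0 ≤ t →
      heatFlow hK (t + t₀) f x ≤ Real.exp (-(lambdaOne G * (t + t₀))) * l1Norm v₀ := by
    intro x t ht
    rw [h.l1Norm_eq]
    exact heatFlow_apply_le_l1 hK hgap (f := f) (fun x => (h.pos x).le) h.summable x
      (by linarith)
  have hnn : ∀ x t, 0 ≤ t → 0 ≤ heatFlow hK (t + t₀) f x := fun x t ht =>
    heatFlow_nonneg hK (fun x => (h.pos x).le) x (by linarith)
  have hreg : ∀ x, ContDiff ℝ 1 fun t =>
      hFactor G p v₀ t₀ t * heatFlow hK (t + t₀) f x := fun x =>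
    (h.contDiff_hFactor hp hl).mul ((contDiff_heatFlow_apply hK f x).comp
      (contDiff_id.add contDiff_const))
  refine ⟨fun x => ⟨?_, ?_⟩, ?_, ?_, fun x t ht => (superSol_pos hK hp hl h x ht.le).le⟩
  · exact (hreg x).continuous.continuousOn.congr fun t ht =>
      superSol_eq hK h x (by linarith [mem_Ici.mp ht])
  · exact (hreg x).contDiffOn.congr fun t ht =>
      superSol_eq hK h x (by linarith [mem_Ioi.mp ht])
  · intro τ _
    obtain ⟨C, hC⟩ := isCompact_Icc.exists_bound_of_continuousOn (s := Icc 0 τ)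
      (h.contDiff_hFactor hp hl).continuous.continuousOn
    refine ⟨C * l1Norm v₀, fun x t ht => ?_⟩
    rw [superSol_eq hK h x (by linarith [ht.1]), abs_mul, abs_of_nonneg (hnn x t ht.1)]
    have hN := h.l1Norm_pos
    refine mul_le_mul (hC t ht) ((hle x t ht.1).trans (mul_le_of_le_one_left hN.le ?_))
      (hnn x t ht.1) ((abs_nonneg _).trans (hC t ht))
    rw [Real.exp_le_one_iff, neg_nonpos]
    exact mul_nonneg hl.le (by linarith [ht.1])
  · intro x t ht
    have hev : superSol G p v₀ t₀ x =ᶠ[𝓝 t] fun t =>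
        hFactor G p v₀ t₀ t * heatFlow hK (t + t₀) f x := by
      filter_upwards [Ioi_mem_nhds ht] with s hs using
        superSol_eq hK h x (by linarith [mem_Ioi.mp hs])
    have hd := (h.hasDerivAt_hFactor hp hl t).fun_mul
      ((hasDerivAt_heatFlow_apply hK f x (t + t₀)).comp_add_const t t₀)
    have hΔ : laplacian G (fun y => superSol G p v₀ t₀ y t) x =
        hFactor G p v₀ t₀ t * laplacian G (fun y => heatFlow hK (t + t₀) f y) x := by
      simp only [superSol_eq hK h _ (show -t₀ ≤ t by linarith), laplacian_eq, ← Finset.mul_sum]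
      ring
    -- The two terms `h Δ P` cancel; what remains is `(h P) ^ p ≤ h' P`.
    rw [hΔ, hev.deriv_eq, hd.deriv, superSol_eq hK h x (by linarith)]
    set P := heatFlow hK (t + t₀) f x
    have hH := h.hFactor_pos hp hl t
    set H := hFactor G p v₀ t₀ t
    have hP0 : 0 ≤ P := hnn x t ht.le
    have hN := h.l1Norm_pos
    have h1 : P ^ (p - 1) ≤
        l1Norm v₀ ^ (p - 1) * Real.exp (-(p - 1) * lambdaOne G * (t + t₀)) := by
      refine (Real.rpow_le_rpow hP0 (hle x t ht.le) (by linarith)).trans_eq ?_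
      rw [Real.mul_rpow (Real.exp_pos _).le hN.le, ← Real.exp_mul, mul_comm]
      ring_nf
    have h2 : P ^ p = P ^ (p - 1) * P := by
      have h3 := Real.rpow_add_one' hP0 (y := p - 1) (by linarith)
      rwa [sub_add_cancel] at h3
    rw [Real.mul_rpow hH.le hP0, h2]
    have h4 := mul_le_mul_of_nonneg_left (mul_le_mul_of_nonneg_right h1 hP0)
      (Real.rpow_nonneg hH.le p)
    linarith

end Supersolution

/-! ### Geometry of the model tree and positivity of `λ₁` -/

namespace IsHomogeneousModelTree

variable {V : Type*} {G : SimpleGraph V} {b : ℕ} {x₀ : V}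

theorem parent_or_child (hG : IsHomogeneousModelTree G b x₀) {x y : V} (h : G.Adj x y) :
    G.dist y x₀ + 1 = G.dist x x₀ ∨ G.dist y x₀ = G.dist x x₀ + 1 := by
  have h1 := hG.connected.dist_triangle (u := x) (v := y) (w := x₀)
  have h2 := hG.connected.dist_triangle (u := y) (v := x) (w := x₀)
  rw [SimpleGraph.dist_eq_one_iff_adj.mpr h] at h1
  rw [SimpleGraph.dist_eq_one_iff_adj.mpr h.symm] at h2
  have h3 : G.dist x x₀ ≠ G.dist y x₀ := fun h3 => hG.not_adj_of_dist_eq x y h3 h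
  omega

theorem finite_neighborSet (hG : IsHomogeneousModelTree G b x₀) (x : V) :
    (G.neighborSet x).Finite := by
  rcases eq_or_ne x x₀ with rfl | hx
  · exact finite_of_encard_eq_coe hG.root_degree
  · refine ((finite_of_encard_eq_coe (k := 1) (hG.encard_parents x hx)).union
      (finite_of_encard_eq_coe (hG.encard_children x hx))).subset fun y hy => ?_
    exact (hG.parent_or_child hy).imp (fun h => ⟨hy, h⟩) fun h => ⟨hy, h⟩

theorem finite_ball (hG : IsHomogeneousModelTree G b x₀) (n : ℕ) :
    {x | G.dist x x₀ ≤ n}.Finite := by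
  induction n with
  | zero =>
    refine (finite_singleton x₀).subset fun x hx => ?_
    exact hG.connected.dist_eq_zero_iff.mp (Nat.le_zero.mp hx)
  | succ n ih =>
    refine (ih.union (ih.biUnion fun y _ => hG.finite_neighborSet y)).subset fun x hx => ?_
    rcases eq_or_ne x x₀ with rfl | hne
    · exact .inl (by simp)
    · obtain ⟨y, hy⟩ := nonempty_of_encard_ne_zero (by rw [hG.encard_parents x hne]; simp)
      refine .inr (mem_biUnion (x := y) ?_ hy.1.symm)
      have h1 := hy.2
      have h2 : G.dist x x₀ ≤ n + 1 := hx
      exact (by omega : G.dist y x₀ ≤ n)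

/-- Balls are finite and exhaust the graph. Countability is needed for a strictly positive summable
function to exist. -/
theorem countable (hG : IsHomogeneousModelTree G b x₀) : Countable V := by
  rw [← countable_univ_iff]
  refine (countable_iUnion fun n => (hG.finite_ball n).countable).mono fun x _ => ?_
  exact mem_iUnion.mpr ⟨G.dist x x₀, le_refl (G.dist x x₀)⟩

variable [G.LocallyFinite]

theorem sum_neighbors_root (hG : IsHomogeneousModelTree G b x₀) (g : ℕ → ℝ) :
    G.degree x₀ = b ∧ ∑ y ∈ G.neighborFinset x₀, g (G.dist y x₀) = b * g 1 := by
  have hd : G.degree x₀ = b := by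
    have := hG.root_degree
    rw [← SimpleGraph.coe_neighborFinset, encard_coe_eq_coe_finsetCard] at this
    exact_mod_cast this
  refine ⟨hd, ?_⟩
  rw [Finset.sum_congr rfl (g := fun _ => g 1) fun y hy => ?_]
  · simp [hd]
  · rw [SimpleGraph.dist_eq_one_iff_adj.mpr ((G.mem_neighborFinset _ _).mp hy).symm]

theorem sum_neighbors (hG : IsHomogeneousModelTree G b x₀) (g : ℕ → ℝ) {x : V} (hx : x ≠ x₀) :
    G.degree x = b + 1 ∧ ∑ y ∈ G.neighborFinset x, g (G.dist y x₀) =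
      g (G.dist x x₀ - 1) + b * g (G.dist x x₀ + 1) := by
  have h1 : ((G.neighborFinset x).filter fun y => G.dist y x₀ + 1 = G.dist x x₀).card = 1 := by
    have := hG.encard_parents x hx
    rw [show {y | G.Adj x y ∧ G.dist y x₀ + 1 = G.dist x x₀} =
      ((G.neighborFinset x).filter fun y => G.dist y x₀ + 1 = G.dist x x₀ : Finset V) by
        ext y; simp, encard_coe_eq_coe_finsetCard] at this
    exact_mod_cast this
  have h2 : ((G.neighborFinset x).filter fun y => ¬ G.dist y x₀ + 1 = G.dist x x₀).card = b := by
    have := hG.encard_children x hx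
    rw [show {y | G.Adj x y ∧ G.dist y x₀ = G.dist x x₀ + 1} =
      ((G.neighborFinset x).filter fun y => ¬ G.dist y x₀ + 1 = G.dist x x₀ : Finset V) by
        ext y
        simp only [mem_ofPred_eq, Finset.coe_filter, SimpleGraph.mem_neighborFinset]
        refine and_congr_right fun hy => ?_
        have := hG.parent_or_child hy
        omega, encard_coe_eq_coe_finsetCard] at this
    exact_mod_cast this
  constructor
  · rw [← SimpleGraph.card_neighborFinset_eq_degree,
      ← Finset.card_filter_add_card_filter_not fun y => G.dist y x₀ + 1 = G.dist x x₀, h1, h2,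
      add_comm]
  · rw [← Finset.sum_filter_add_sum_filter_not _ fun y => G.dist y x₀ + 1 = G.dist x x₀,
      Finset.sum_congr rfl (g := fun _ => g (G.dist x x₀ - 1)),
      Finset.sum_congr (s₁ := Finset.filter (fun y => ¬ _) _) rfl
        (g := fun _ => g (G.dist x x₀ + 1))]
    · simp [h1, h2]
    · intro y hy
      rw [Finset.mem_filter, SimpleGraph.mem_neighborFinset] at hy
      rw [(hG.parent_or_child hy.1).resolve_left hy.2]
    · intro y hy
      rw [← (Finset.mem_filter.mp hy).2, Nat.add_sub_cancel]

theorem degree_le (hG : IsHomogeneousModelTree G b x₀) (x : V) : G.degree x ≤ b + 1 := by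
  rcases eq_or_ne x x₀ with rfl | hx
  · rw [(hG.sum_neighbors_root fun _ => 0).1]
    exact Nat.le_succ b
  · rw [(hG.sum_neighbors (fun _ => 0) hx).1]

/-- The radial function `b ^ (-r / 2)` is a strict supersolution of the Laplace equation. -/
theorem sum_neighbors_pow_le (hG : IsHomogeneousModelTree G b x₀) (hb : 1 ≤ b) (x : V) :
    ∑ y ∈ G.neighborFinset x, (√b)⁻¹ ^ G.dist y x₀ ≤
      (G.degree x - (√b - 1) ^ 2) * (√b)⁻¹ ^ G.dist x x₀ := by
  have hs : 1 ≤ √(b : ℝ) := Real.one_le_sqrt.mpr (by exact_mod_cast hb)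
  have hs0 : 0 < √(b : ℝ) := by linarith
  have hsq : (b : ℝ) = √b ^ 2 := (Real.sq_sqrt (Nat.cast_nonneg b)).symm
  rcases eq_or_ne x x₀ with rfl | hx
  · obtain ⟨h1, h2⟩ := hG.sum_neighbors_root fun n => (√(b : ℝ))⁻¹ ^ n
    rw [h2, h1, SimpleGraph.dist_self, pow_one, pow_zero]
    have : (b : ℝ) * (√b)⁻¹ = √b := by
      rw [← div_eq_mul_inv, Real.div_sqrt]
    -- At the root the claim is `√b ≤ 2 √b - 1`, that is `√b ≥ 1`.
    nlinarith
  · obtain ⟨h1, h2⟩ := hG.sum_neighbors (fun n => (√(b : ℝ))⁻¹ ^ n) hx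
    obtain ⟨n, hn⟩ := Nat.exists_eq_succ_of_ne_zero
      (mt hG.connected.dist_eq_zero_iff.mp hx)
    rw [h2, h1, hn, Nat.succ_eq_add_one, Nat.add_sub_cancel]
    push_cast
    -- Away from the root equality holds, because `b + 1 - (√b - 1) ^ 2 = 2 √b`.
    refine le_of_eq ?_
    have hi : √(b : ℝ) * (√b)⁻¹ = 1 := mul_inv_cancel₀ hs0.ne'
    set s := √(b : ℝ)
    rw [hsq]
    set β := s⁻¹
    calc β ^ n + s ^ 2 * β ^ (n + 1 + 1) = β ^ n * (1 + (s * β) ^ 2) := by ring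
      _ = β ^ n * (2 * (s * β)) := by rw [hi]; ring
      _ = _ := by ring

theorem lambdaOne_pos (hG : IsHomogeneousModelTree G b x₀) (hb : 2 ≤ b) :
    0 < lambdaOne G ∧
      ∀ f : L2 V, ⟪lazyOp hG.degree_le f, f⟫ ≤ ((b + 1 : ℕ) - lambdaOne G) * ‖f‖ ^ 2 := by
  have : Nonempty V := ⟨x₀⟩
  have hs : 1 < √(b : ℝ) := Real.lt_sqrt_of_sq_lt (by norm_num; exact_mod_cast hb)
  obtain ⟨h1, h2⟩ := le_lambdaOne hG.degree_le (c := (√b - 1) ^ 2) fun f =>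
    inner_lazyOp_self_le hG.degree_le (φ := fun x => (√b)⁻¹ ^ G.dist x x₀) (sq_nonneg _)
      (fun x => by positivity) (hG.sum_neighbors_pow_le (by omega)) f
  exact ⟨lt_of_lt_of_le (pow_pos (by linarith) 2) h1, h2⟩

end IsHomogeneousModelTree

theorem exists_isAdmissible {V : Type*} [Countable V] (G : SimpleGraph V) (p : ℝ) :
    ∃ (v₀ : V → ℝ) (t₀ : ℝ), IsAdmissible G p v₀ t₀ := by
  have := Encodable.ofCountable V
  obtain ⟨v, hv, c, hc, -⟩ := posSumOfEncodable one_pos V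
  -- The time left as `_` is unified with the required lower bound plus one.
  exact ⟨v, _, hv, hc.summable, ⟨c, fun x => le_hasSum hc x fun y _ => (hv y).le⟩, lt_add_one _⟩

end ModelTree

end

theorem corollary3p4 {V : Type*} (G : SimpleGraph V) (b : ℕ) (x₀ : V) (hb : 2 ≤ b)
    (hG : ModelTree.IsHomogeneousModelTree G b x₀) (p : ℝ) (hp : 1 < p) :
    (∃ (v₀ : V → ℝ) (t₀ : ℝ), ModelTree.IsAdmissible G p v₀ t₀) ∧
    ∀ (v₀ : V → ℝ) (t₀ : ℝ), ModelTree.IsAdmissible G p v₀ t₀ →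
      ModelTree.IsGlobalSupersolution G p (ModelTree.superSol G p v₀ t₀) ∧
      (∀ x : V, ∀ t : ℝ, 0 ≤ t → 0 < ModelTree.superSol G p v₀ t₀ x t) ∧
      ∀ u₀ : V → ℝ, (∀ x, 0 ≤ u₀ x ∧ u₀ x ≤ ModelTree.superSol G p v₀ t₀ x 0) →
        ∃ u : V → ℝ → ℝ, ModelTree.IsGlobalSolution G p u₀ u := by

  have : Nonempty V := ⟨x₀⟩
  have := hG.countable
  let _ : G.LocallyFinite := fun x => (hG.finite_neighborSet x).fintype
  obtain ⟨hl, hgap⟩ := hG.lambdaOne_pos hb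
  refine ⟨ModelTree.exists_isAdmissible G p, fun v₀ t₀ h => ?_⟩
  have hsup := ModelTree.isGlobalSupersolution_superSol hG.degree_le hp hl hgap h
  refine ⟨hsup, fun x t ht => ModelTree.superSol_pos hG.degree_le hp hl h x ht, fun u₀ hu₀ => ?_⟩
  exact ModelTree.exists_isGlobalSolution_of_supersolution hG.degree_le (by linarith) hsup hu₀
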